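/- **Setting.** Let $0\le\gamma<1$, $\alpha=\frac{4}{3+\gamma}$, let $\Omega\subset\mathbb R^n$ be a bounded domain, and let $\Delta_\infty u=\sum_{i,j}D_{ij}u\,D_iu\,D_ju$. Let $\delta>0$ and let $\mathcal B:\mathbb R\to\mathbb R$ be Lipschitz with $0\le\mathcal B\le1$ on $[0,\infty)$, $\mathcal B=0$ on $(-\infty,\delta/2]$ and $\mathcal B=1$ on $[\delta,\infty)$; for $\varepsilon>0$ put $\mathcal B_\varepsilon(s)=\mathcal B(s/\varepsilon^\alpha)$. For nonnegative boundary data $\varphi_\varepsilon$ on $\partial\Omega$ consider $$(P_\varepsilon)\qquad \Delta_\infty u=\mathcal B_\varepsilon(u)\,u^{-\gamma}\ \text{ in }\Omega,\qquad u=\varphi_\varepsilon\ \text{ on }\partial\Omega .$$ The minimal solution of $(P_\varepsilon)$ is the nonnegative viscosity solution $u_\varepsilon\in C(\overline\Omega)$ with $u_\varepsilon\le w$ for every nonnegative viscosity supersolution $w\in C(\overline\Omega)$ with $w=\varphi_\varepsilon$ on $\partial\Omega$. Let $u:\Omega\to\mathbb R$ be a limiting solution: there are $\varepsilon_k\to0^+$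 and nonnegative boundary data $\varphi_{\varepsilon_k}\to\varphi$ pointwise on $\partial\Omega$ such that the minimal solutions $u_{\varepsilon_k}$ of $(P_{\varepsilon_k})$ converge to $u$ locally uniformly in $\Omega$; assume $u\in L^\infty(\Omega)$. Write $\{u>0\}=\{x\in\Omega: u(x)>0\}$. Let $\Omega'\Subset\Omega$ be a subdomain, and let $\operatorname{dist}(\Omega',\partial\Omega)=\inf\{|a-b|:a\in\Omega',\,b\in\partial\Omega\}$. **Corollary (uniform density estimates).** There are constants $c>0$ and $\tau\in(0,\frac12)$, depending only on $n$, $\gamma$, $\operatorname{dist}(\Omega',\partial\Omega)$ and an upper bound for $\|u\|_{L^\infty(\Omega)}$, such that: 1. for every $x\in\Omega'\cap\{u>0\}$ and every $0<\kappa<\operatorname{dist}(\Omega',\partial\Omega)$, $$\frac{\mathcal L^n\big(B_\kappa(x)\cap\{u>0\}\big)}{\mathcal L^n\big(B_\kappa(x)\big)}\ \ge\ c;$$ 2. the free boundary is $\tau$-porous in $\Omega'$: for every $x\in\Omega'\cap\partial\{u>0\}$ and every $0<\rho<\operatorname{dist}(\Omega',\partial\Omega)$ there is $y\in\mathbb R^n$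 with $B_{\tau\rho}(y)\subset B_\rho(x)\setminus\partial\{u>0\}$. -/

import Mathlib

open Set Filter Topology MeasureTheory
open scoped ENNReal NNReal

namespace SingInfLap

/-- The Euclidean space `ℝⁿ`. -/
abbrev Rn (n : ℕ) : Type := EuclideanSpace ℝ (Fin n)

/-- The infinity Laplacian `Δ_∞ φ = ∑ᵢⱼ Dᵢⱼφ Dᵢφ Dⱼφ = ⟨D²φ Dφ, Dφ⟩`, written without coordinates:
the second derivative of `φ` at `x`, evaluated twice on the gradient of `φ` at `x`. It is only
evaluated at points near which `φ` is of class `C²`. -/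
noncomputable def infLaplacian {n : ℕ} (φ : Rn n → ℝ) (x : Rn n) : ℝ :=
  fderiv ℝ (fderiv ℝ φ) x (gradient φ x) (gradient φ x)

/-- `u` satisfies `Δ_∞ u ≥ G(u)` in the viscosity sense in the open set `Ω`. -/
def IsViscositySubsolution {n : ℕ} (Ω : Set (Rn n)) (G : ℝ → ℝ) (u : Rn n → ℝ) : Prop :=
  ∀ x ∈ Ω, ∀ φ : Rn n → ℝ, ContDiffAt ℝ 2 φ x →
    IsLocalMax (fun y => u y - φ y) x → G (u x) ≤ infLaplacian φ x

/-- `u` satisfies `Δ_∞ u ≤ G(u)` in the viscosity sense in the open set `Ω`. -/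
def IsViscositySupersolution {n : ℕ} (Ω : Set (Rn n)) (G : ℝ → ℝ) (u : Rn n → ℝ) : Prop :=
  ∀ x ∈ Ω, ∀ φ : Rn n → ℝ, ContDiffAt ℝ 2 φ x →
    IsLocalMin (fun y => u y - φ y) x → infLaplacian φ x ≤ G (u x)

/-- The exponent `α = 4 / (3 + γ)`. -/
noncomputable def alpha (γ : ℝ) : ℝ := 4 / (3 + γ)

/-- A Lipschitz function `𝓑` with `0 ≤ 𝓑 ≤ 1` on `[0, ∞)`, `𝓑 = 0` on `(-∞, δ/2]` and
`𝓑 = 1` on `[δ, ∞)`. -/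
structure IsCutoff (δ : ℝ) (B : ℝ → ℝ) : Prop where
  lipschitz : ∃ K : ℝ≥0, LipschitzWith K B
  nonneg : ∀ s, 0 ≤ s → 0 ≤ B s
  le_one : ∀ s, 0 ≤ s → B s ≤ 1
  eq_zero : ∀ s, s ≤ δ / 2 → B s = 0
  eq_one : ∀ s, δ ≤ s → B s = 1

/-- The penalized source `s ↦ 𝓑_ε(s) s^{-γ}`, `𝓑_ε(s) = 𝓑(s / ε^α)`. For a cutoff `𝓑` as above it
vanishes for `s ≤ δ ε^α / 2`, whatever value the power has at `s ≤ 0`. -/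
noncomputable def source (γ : ℝ) (B : ℝ → ℝ) (ε s : ℝ) : ℝ :=
  B (s / ε ^ alpha γ) * s ^ (-γ)

/-- The class over which the infimum is taken in Perron's method for
`Δ_∞ w = G(w)` in `Ω`, `w = φ` on `∂Ω`: nonnegative functions, continuous on the closure of `Ω`,
that are viscosity supersolutions in `Ω` and attain the boundary data. -/
structure IsPerronSupersolution {n : ℕ} (Ω : Set (Rn n)) (G : ℝ → ℝ) (φ w : Rn n → ℝ) :
    Prop where
  continuousOn : ContinuousOn w (closure Ω)
  nonneg : ∀ x ∈ closure Ω, 0 ≤ w x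
  supersolution : IsViscositySupersolution Ω G w
  boundary : ∀ x ∈ frontier Ω, w x = φ x

/-- The minimal (Perron) viscosity solution of `Δ_∞ u = G(u)` in `Ω`, `u = φ` on `∂Ω`: a nonnegative
viscosity solution, continuous on the closure of `Ω`, that attains the boundary data and lies
below every member of the Perron class. -/
structure IsMinimalSolution {n : ℕ} (Ω : Set (Rn n)) (G : ℝ → ℝ) (φ u : Rn n → ℝ) :
    Prop extends IsPerronSupersolution Ω G φ u where
  subsolution : IsViscositySubsolution Ω G u
  minimal : ∀ w : Rn n → ℝ, IsPerronSupersolution Ω G φ w → ∀ x ∈ closure Ω, u x ≤ w x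

/-- `u` is a limiting solution of `Δ_∞ u = u^{-γ}` in `Ω ∩ {u > 0}`, `u = φ` on `∂Ω`: for some
sequence `ε_k → 0⁺` and nonnegative boundary data `φ_k → φ`, it is the locally uniform limit in `Ω`
of the minimal solutions `u_k` of the penalized problems
`Δ_∞ u_k = 𝓑_{ε_k}(u_k) u_k^{-γ}` in `Ω`, `u_k = φ_k` on `∂Ω`. -/
def IsLimitingSolution {n : ℕ} (γ : ℝ) (B : ℝ → ℝ) (Ω : Set (Rn n)) (φ u : Rn n → ℝ) : Prop :=
  ∃ (ε : ℕ → ℝ) (φs us : ℕ → Rn n → ℝ),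
    (∀ k, 0 < ε k) ∧ Tendsto ε atTop (𝓝 0) ∧
    (∀ k, ∀ x ∈ frontier Ω, 0 ≤ φs k x) ∧
    (∀ x ∈ frontier Ω, Tendsto (fun k => φs k x) atTop (𝓝 (φ x))) ∧
    (∀ k, IsMinimalSolution Ω (source γ B (ε k)) (φs k) (us k)) ∧
    TendstoLocallyUniformlyOn us u atTop Ω

/-- The positivity set `{u > 0} = {x ∈ Ω : u(x) > 0}`. -/
def posSet {n : ℕ} (Ω : Set (Rn n)) (u : Rn n → ℝ) : Set (Rn n) := {x ∈ Ω | 0 < u x}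

/-- The distance `inf {|a - b| : a ∈ A, b ∈ B}` between two (nonempty) sets. -/
noncomputable def setDist {n : ℕ} (A B : Set (Rn n)) : ℝ :=
  sInf {r : ℝ | ∃ a ∈ A, ∃ b ∈ B, r = dist a b}

/-- Porosity of `E` at `x` with constant `τ`, at all radii `ρ < ρ₀`: the ball `B_ρ(x)` contains a
ball of radius `τ ρ` that does not meet `E`. -/
def PorousAt {n : ℕ} (τ ρ₀ : ℝ) (E : Set (Rn n)) (x : Rn n) : Prop :=
  ∀ ρ : ℝ, 0 < ρ → ρ < ρ₀ → ∃ y : Rn n, Metric.ball y (τ * ρ) ⊆ Metric.ball x ρ \ E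

end SingInfLap

/-!
Write `v = u ^ (1 / α)`; both estimates follow once every ball `B_κ(x)` with `u(x) > 0` is known to
contain a ball of radius proportional to `κ` on which `u > 0`.

Nondegeneracy: if a penalized solution that is positive at `x` stayed below `L = (r / 2) ^ α` on
`B_r(x)`, a translate of the paraboloid `L |y - x|² / r²` would touch it from above inside the
ball. There the source is at least `L ^ (-γ)`, which exceeds the infinity Laplacian of the
paraboloid. So in the limit `v ≥ r / 2` somewhere in the closed ball.

Linear decay: for a steep slope `S`, the powers `(b - S |y - z|) ^ α` of cones have infinity
Laplacian larger than the source, so they cannot touch a penalized solution from below away from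
the vertex. Hence `v(z) ≤ v(y) + S |y - z|` as soon as `v(z) < S R` and `B_R(z) ⊆ Ω`, and `u > 0`
on the ball of radius `v(z) / S` around `z`. The last condition is met by a slope depending only on
`γ`, the distance to the boundary and the bound for `u`.
-/

namespace SingInfLap

section Calculus

theorem gradient_comp {E : Type*} [NormedAddCommGroup E] [InnerProductSpace ℝ E]
    [CompleteSpace E] {F : ℝ → ℝ} {F' : ℝ} {q : E → ℝ} {p : E} (hF : HasDerivAt F F' (q p))
    (hq : DifferentiableAt ℝ q p) :
    gradient (fun y => F (q y)) p = F' • gradient q p := by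
  have hcomp : fderiv ℝ (fun y => F (q y)) p = F' • fderiv ℝ q p :=
    (hF.comp_hasFDerivAt p hq.hasFDerivAt).fderiv
  rw [gradient, gradient, hcomp, map_smul]

variable {n : ℕ} {p z : Rn n}

theorem infLaplacian_comp {F F' : ℝ → ℝ} {F'' : ℝ} {q : Rn n → ℝ}
    (hF : ∀ᶠ s in 𝓝 (q p), HasDerivAt F (F' s) s) (hF' : HasDerivAt F' F'' (q p))
    (hq : ContDiffAt ℝ 2 q p) :
    infLaplacian (fun y => F (q y)) p =
      F'' * F' (q p) ^ 2 * ‖gradient q p‖ ^ 4 + F' (q p) ^ 3 * infLaplacian q p := by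
  have hfderiv : fderiv ℝ (fun y => F (q y)) =ᶠ[𝓝 p] fun y => F' (q y) • fderiv ℝ q y := by
    filter_upwards [hq.continuousAt.eventually hF, hq.eventually (by simp)] with y hy hqy
    exact (hy.comp_hasFDerivAt y (hqy.differentiableAt (by simp)).hasFDerivAt).fderiv
  have hqp : DifferentiableAt ℝ q p := hq.differentiableAt (by simp)
  have hDq : DifferentiableAt ℝ (fderiv ℝ q) p :=
    (hq.fderiv_right (m := 1) (by norm_num)).differentiableAt (by simp)
  have hhess : fderiv ℝ (fun y => F' (q y) • fderiv ℝ q y) p =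
      F' (q p) • fderiv ℝ (fderiv ℝ q) p + (F'' • fderiv ℝ q p).smulRight (fderiv ℝ q p) :=
    ((hF'.comp_hasFDerivAt p hqp.hasFDerivAt).smul hDq.hasFDerivAt).fderiv
  have hnorm : fderiv ℝ q p (gradient q p) = ‖gradient q p‖ ^ 2 := by
    rw [← inner_gradient_left, real_inner_self_eq_norm_sq]
  rw [infLaplacian, hfderiv.fderiv_eq, hhess, gradient_comp hF.self_of_nhds hqp]
  simp only [map_smul, add_apply, smul_apply, ContinuousLinearMap.smulRight_apply, hnorm,
    infLaplacian, smul_eq_mul]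
  ring

theorem contDiffAt_norm_sub_sq : ContDiffAt ℝ 2 (fun y : Rn n => ‖y - z‖ ^ 2) p :=
  (contDiffAt_id.sub contDiffAt_const).norm_sq ℝ

theorem hasFDerivAt_norm_sub_sq :
    HasFDerivAt (fun y : Rn n => ‖y - z‖ ^ 2) ((2 : ℝ) • innerSL ℝ (p - z)) p := by
  refine ((hasFDerivAt_id p).sub_const z).norm_sq.congr_fderiv ?_
  ext v
  simp

theorem gradient_norm_sub_sq : gradient (fun y => ‖y - z‖ ^ 2) p = (2 : ℝ) • (p - z) := by
  refine HasGradientAt.gradient (hasGradientAt_iff_hasFDerivAt.2 ?_)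
  refine hasFDerivAt_norm_sub_sq.congr_fderiv ?_
  ext v
  simp

theorem infLaplacian_norm_sub_sq : infLaplacian (fun y => ‖y - z‖ ^ 2) p = 8 * ‖p - z‖ ^ 2 := by
  have hfderiv : fderiv ℝ (fun y : Rn n => ‖y - z‖ ^ 2) =
      fun y => ((2 : ℝ) • innerSL ℝ (E := Rn n)) (y - z) :=
    funext fun y => hasFDerivAt_norm_sub_sq.fderiv
  have hhess : fderiv ℝ (fun y => ((2 : ℝ) • innerSL ℝ (E := Rn n)) (y - z)) p =
      (2 : ℝ) • innerSL ℝ := by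
    rw [fderiv_comp_sub, ContinuousLinearMap.fderiv]
  rw [infLaplacian, hfderiv, hhess, gradient_norm_sub_sq]
  change 2 * inner ℝ ((2 : ℝ) • (p - z)) ((2 : ℝ) • (p - z)) = 8 * ‖p - z‖ ^ 2
  rw [real_inner_self_eq_norm_sq, norm_smul, Real.norm_two]
  ring

theorem infLaplacian_const_mul_norm_sub_sq (A : ℝ) :
    infLaplacian (fun y => A * ‖y - z‖ ^ 2) p = 8 * A ^ 3 * ‖p - z‖ ^ 2 := by
  rw [infLaplacian_comp (F := fun s => A * s) (F' := fun _ => A) (F'' := 0)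
    (Eventually.of_forall fun s => by simpa using (hasDerivAt_id s).const_mul A)
    (hasDerivAt_const _ _) contDiffAt_norm_sub_sq, infLaplacian_norm_sub_sq]
  ring

theorem contDiffAt_norm_sub (hpz : p ≠ z) : ContDiffAt ℝ 2 (fun y => ‖y - z‖) p :=
  (contDiffAt_id.sub contDiffAt_const).norm ℝ (sub_ne_zero.2 hpz)

theorem norm_gradient_norm_sub (hpz : p ≠ z) : ‖gradient (fun y => ‖y - z‖) p‖ = 1 := by
  have hnorm : 0 < ‖p - z‖ := norm_pos_iff.2 (sub_ne_zero.2 hpz)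
  -- The chain rule for `‖y - z‖ ^ 2` is solved for the gradient of the distance.
  have hsq := gradient_comp (F := fun s : ℝ => s ^ 2) (q := fun y => ‖y - z‖)
    (hasDerivAt_pow 2 ‖p - z‖) ((contDiffAt_norm_sub hpz).differentiableAt (by simp))
  rw [gradient_norm_sub_sq] at hsq
  have := congrArg norm hsq
  simpa [norm_smul, hnorm.ne'] using this.symm

theorem infLaplacian_norm_sub (hpz : p ≠ z) : infLaplacian (fun y => ‖y - z‖) p = 0 := by
  have hnorm : 0 < ‖p - z‖ := norm_pos_iff.2 (sub_ne_zero.2 hpz)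
  -- By the eikonal equation the first term of the chain rule for `‖y - z‖ ^ 2` accounts for all of
  -- its infinity Laplacian.
  have hsq := infLaplacian_comp (F := fun s : ℝ => s ^ 2) (F' := fun s => 2 * s) (F'' := 2)
    (Eventually.of_forall fun s => by simpa using hasDerivAt_pow 2 s)
    (by simpa using (hasDerivAt_id ‖p - z‖).const_mul 2) (contDiffAt_norm_sub hpz)
  rw [infLaplacian_norm_sub_sq, norm_gradient_norm_sub hpz] at hsq
  have hzero : (2 * ‖p - z‖) ^ 3 * infLaplacian (fun y => ‖y - z‖) p = 0 := by linarith
  exact (mul_eq_zero.1 hzero).resolve_left (by positivity)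

variable {a b S : ℝ}

theorem contDiffAt_cone_rpow (hpz : p ≠ z) (hb : 0 < b - S * ‖p - z‖) :
    ContDiffAt ℝ 2 (fun y => (b - S * ‖y - z‖) ^ a) p :=
  (contDiffAt_const.sub (contDiffAt_const.mul (contDiffAt_norm_sub hpz))).rpow_const_of_ne hb.ne'

theorem infLaplacian_cone_rpow (hpz : p ≠ z) (hb : 0 < b - S * ‖p - z‖) :
    infLaplacian (fun y => (b - S * ‖y - z‖) ^ a) p =
      a ^ 3 * (a - 1) * S ^ 4 * (b - S * ‖p - z‖) ^ (3 * a - 4) := by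
  have hcone (t : ℝ) : HasDerivAt (fun t => b - S * t) (-S) t := by
    simpa using ((hasDerivAt_id t).const_mul S).const_sub b
  have hF : ∀ᶠ t in 𝓝 ‖p - z‖,
      HasDerivAt (fun t => (b - S * t) ^ a) (-S * a * (b - S * t) ^ (a - 1)) t := by
    filter_upwards [(hcone _).continuousAt.eventually (lt_mem_nhds hb)] with t ht
    exact (hcone t).rpow_const (Or.inl ht.ne')
  have hF' : HasDerivAt (fun t => -S * a * (b - S * t) ^ (a - 1))
      (-S * a * (-S * (a - 1) * (b - S * ‖p - z‖) ^ (a - 1 - 1))) ‖p - z‖ :=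
    ((hcone _).rpow_const (Or.inl hb.ne')).const_mul _
  refine (infLaplacian_comp (q := fun y => ‖y - z‖) hF hF' (contDiffAt_norm_sub hpz)).trans ?_
  rw [norm_gradient_norm_sub hpz, infLaplacian_norm_sub hpz]
  set X := b - S * ‖p - z‖
  have hpow : X ^ (3 * a - 4) = X ^ (a - 1 - 1) * (X ^ (a - 1)) ^ 2 := by
    rw [← Real.rpow_mul_natCast hb.le, ← Real.rpow_add hb]
    congr 1
    push_cast
    ring
  rw [hpow]
  ring

end Calculus

section Geometry

theorem exists_ball_subset_sdiff_frontier {X : Type*} [PseudoMetricSpace X] {A : Set X} {x : X}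
    {σ ρ : ℝ} (hρ : 0 < ρ) (hx : x ∈ closure A)
    (hA : ∀ y ∈ A, dist y x < ρ / 2 →
      ∃ z, Metric.ball z (σ * (ρ / 2)) ⊆ Metric.ball y (ρ / 2) ∩ A) :
    ∃ z, Metric.ball z (σ / 2 * ρ) ⊆ Metric.ball x ρ \ frontier A := by
  obtain ⟨y, hyA, hxy⟩ := Metric.mem_closure_iff.1 hx (ρ / 2) (half_pos hρ)
  rw [dist_comm] at hxy
  obtain ⟨z, hz⟩ := hA y hyA hxy
  rw [show σ * (ρ / 2) = σ / 2 * ρ by ring, subset_inter_iff] at hz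
  refine ⟨z, subset_sdiff.2 ⟨hz.1.trans (Metric.ball_subset_ball' (by linarith)), ?_⟩⟩
  exact disjoint_interior_frontier.mono_left (interior_maximal hz.2 Metric.isOpen_ball)

theorem pow_finrank_le_measureReal_div {E : Type*} [NormedAddCommGroup E] [NormedSpace ℝ E]
    [FiniteDimensional ℝ E] [MeasurableSpace E] [BorelSpace E] (μ : Measure E)
    [μ.IsAddHaarMeasure] {A : Set E} {x z : E} {σ κ : ℝ} (hσ : 0 < σ) (hκ : 0 < κ)
    (hz : Metric.ball z (σ * κ) ⊆ Metric.ball x κ ∩ A) :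
    σ ^ Module.finrank ℝ E ≤ μ.real (Metric.ball x κ ∩ A) / μ.real (Metric.ball x κ) := by
  have hpos : 0 < μ.real (Metric.ball x κ) :=
    ENNReal.toReal_pos (Metric.measure_ball_pos μ x hκ).ne' measure_ball_lt_top.ne
  have hscale : μ.real (Metric.ball z (σ * κ)) =
      σ ^ Module.finrank ℝ E * μ.real (Metric.ball x κ) := by
    rw [Measure.addHaar_real_ball_center μ x, measureReal_def, measureReal_def,
      Measure.addHaar_ball_mul_of_pos μ z hσ, ENNReal.toReal_mul,
      ENNReal.toReal_ofReal (by positivity)]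
  rw [le_div_iff₀ hpos, ← hscale]
  exact measureReal_mono hz (measure_ne_top_of_subset inter_subset_left measure_ball_lt_top.ne)

theorem ball_subset_of_forall_mem_frontier {E : Type*} [NormedAddCommGroup E] [NormedSpace ℝ E]
    {Ω : Set E} {x : E} {r : ℝ} (hΩ : IsOpen Ω) (hx : x ∈ Ω)
    (hr : ∀ y ∈ frontier Ω, r ≤ dist y x) : Metric.ball x r ⊆ Ω := by
  rcases le_or_gt r 0 with hr0 | hr0
  · simp [Metric.ball_eq_empty.2 hr0]
  refine (convex_ball x r).isPreconnected.subset_of_closure_inter_subset hΩ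
    ⟨x, Metric.mem_ball_self hr0, hx⟩ ?_
  rintro y ⟨hycl, hyr⟩
  by_contra hyΩ
  exact (hr y ⟨hycl, by rwa [hΩ.interior_eq]⟩).not_gt hyr

theorem setDist_le_dist {n : ℕ} {A B : Set (Rn n)} {a b : Rn n} (ha : a ∈ A) (hb : b ∈ B) :
    setDist A B ≤ dist a b :=
  csInf_le ⟨0, by rintro _ ⟨a, -, b, -, rfl⟩; exact dist_nonneg⟩ ⟨a, ha, b, hb, rfl⟩

theorem ball_setDist_frontier_subset {n : ℕ} {A Ω : Set (Rn n)} {x : Rn n} (hΩ : IsOpen Ω)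
    (hxA : x ∈ A) (hxΩ : x ∈ Ω) : Metric.ball x (setDist A (frontier Ω)) ⊆ Ω :=
  ball_subset_of_forall_mem_frontier hΩ hxΩ fun y hy => dist_comm x y ▸ setDist_le_dist hxA hy

theorem enorm_le_eLpNorm_top_restrict {X E : Type*} [TopologicalSpace X] [MeasurableSpace X]
    [SeminormedAddCommGroup E] {μ : Measure X} [μ.IsOpenPosMeasure] {U : Set X} {f : X → E}
    (hU : IsOpen U) (hf : ContinuousOn f U) {x : X} (hx : x ∈ U) :
    ‖f x‖ₑ ≤ eLpNorm f ∞ (μ.restrict U) := by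
  set C := eLpNorm f ∞ (μ.restrict U) with hC
  have hopen : IsOpen (U ∩ (fun y => ‖f y‖ₑ) ⁻¹' Ioi C) :=
    hf.enorm.isOpen_inter_preimage hU isOpen_Ioi
  have hnull : μ (U ∩ (fun y => ‖f y‖ₑ) ⁻¹' Ioi C) = 0 := by
    have hae : ∀ᵐ y ∂μ.restrict U, ‖f y‖ₑ ≤ C := by
      rw [hC, eLpNorm_exponent_top]
      exact ae_le_eLpNormEssSup
    simpa only [ae_iff, Classical.not_imp, not_le] using! ae_imp_of_ae_restrict hae
  by_contra! hlt
  exact (hopen.eq_empty_of_measure_zero hnull).le ⟨hx, hlt⟩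

theorem le_max_of_eLpNorm_top_restrict_le {X : Type*} [TopologicalSpace X] [MeasurableSpace X]
    {μ : Measure X} [μ.IsOpenPosMeasure] {U : Set X} {f : X → ℝ} {M : ℝ} (hU : IsOpen U)
    (hf : ContinuousOn f U) (hM : eLpNorm f ∞ (μ.restrict U) ≤ ENNReal.ofReal M) {x : X}
    (hx : x ∈ U) : f x ≤ max M 0 := by
  have hle : ‖f x‖ₑ ≤ (M.toNNReal : ℝ≥0∞) := (enorm_le_eLpNorm_top_restrict hU hf hx).trans hM
  calc f x ≤ ‖f x‖ := Real.le_norm_self _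
    _ ≤ M.toNNReal := enorm_le_coe.1 hle
    _ = max M 0 := Real.coe_toNNReal' M

theorem le_add_mul_norm_sub_of_not_isLocalMin {E : Type*} [SeminormedAddCommGroup E]
    [ProperSpace E] {v : E → ℝ} {z y : E} {R S : ℝ}
    (hv : ContinuousOn v (Metric.closedBall z R)) (hv0 : ∀ p ∈ Metric.closedBall z R, 0 ≤ v p)
    (hS : 0 ≤ S) (hz : v z ≤ S * R)
    (hmin : ∀ p ∈ Metric.ball z R, p ≠ z → ¬ IsLocalMin (fun y => v y + S * ‖y - z‖) p)
    (hy : y ∈ Metric.closedBall z R) : v z ≤ v y + S * ‖y - z‖ := by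
  obtain ⟨p, hp, hpmin⟩ := (isCompact_closedBall z R).exists_isMinOn ⟨y, hy⟩
    (f := fun y => v y + S * ‖y - z‖) (hv.add (by fun_prop))
  suffices hpz : v z ≤ v p + S * ‖p - z‖ from hpz.trans (hpmin hy)
  by_cases hpR : p ∈ Metric.ball z R
  · by_cases hpz : p = z
    · simp [hpz]
    · exact absurd (hpmin.isLocalMin (Metric.closedBall_mem_nhds_of_mem hpR)) (hmin p hpR hpz)
  · rw [Metric.mem_ball, dist_eq_norm, not_lt] at hpR
    calc v z ≤ S * R := hz
      _ ≤ S * ‖p - z‖ := by gcongr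
      _ ≤ v p + S * ‖p - z‖ := le_add_of_nonneg_left (hv0 p hp)

end Geometry

section Comparison

variable {n : ℕ} {Ω : Set (Rn n)} {G : ℝ → ℝ} {u : Rn n → ℝ}

theorem IsViscositySubsolution.exists_lt {L r : ℝ} {x : Rn n}
    (hu : IsViscositySubsolution Ω G u) (hc : ContinuousOn u (Metric.closedBall x r))
    (hball : Metric.closedBall x r ⊆ Ω) (hr : 0 < r) (hx : 0 < u x)
    (hG : ∀ s ∈ Icc (u x) L, 8 * L ^ 3 / r ^ 4 < G s) :
    ∃ z ∈ Metric.closedBall x r, L < u z := by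
  by_contra! hle
  have hxr : x ∈ Metric.closedBall x r := Metric.mem_closedBall_self hr.le
  have hL : 0 < L := hx.trans_le (hle x hxr)
  set A : ℝ := L / r ^ 2 with hA
  have : 0 ≤ A := by positivity
  obtain ⟨z, hz, hmax⟩ := (isCompact_closedBall x r).exists_isMaxOn ⟨x, hxr⟩
    (f := fun y => u y - A * ‖y - x‖ ^ 2) (hc.sub (by fun_prop))
  have hxz : u x ≤ u z - A * ‖z - x‖ ^ 2 := by simpa using hmax hxr
  have hzr : ‖z - x‖ < r := by
    by_contra! hge
    have : L ≤ A * ‖z - x‖ ^ 2 := calc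
      L = A * r ^ 2 := by rw [hA]; field_simp
      _ ≤ A * ‖z - x‖ ^ 2 := by gcongr
    linarith [hle z hz]
  have hloc : IsLocalMax (fun y => u y - A * ‖y - x‖ ^ 2) z :=
    hmax.isLocalMax (Metric.closedBall_mem_nhds_of_mem (by rwa [Metric.mem_ball, dist_eq_norm]))
  have hsub := hu z (hball hz) _ (contDiffAt_const.mul contDiffAt_norm_sub_sq) hloc
  rw [infLaplacian_const_mul_norm_sub_sq] at hsub
  have huz : u z ∈ Icc (u x) L := ⟨hxz.trans (sub_le_self _ (by positivity)), hle z hz⟩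
  refine (hG _ huz).not_ge (hsub.trans ?_)
  calc 8 * A ^ 3 * ‖z - x‖ ^ 2 ≤ 8 * A ^ 3 * r ^ 2 := by gcongr
    _ = 8 * L ^ 3 / r ^ 4 := by rw [hA]; field_simp

variable {a S η : ℝ} {z : Rn n}

theorem IsViscositySupersolution.not_isLocalMin_rpow_add_norm_sub {p : Rn n}
    (hu : IsViscositySupersolution Ω G u) (hp : p ∈ Ω) (hpz : p ≠ z) (ha : 0 < a)
    (hpos : ∀ᶠ y in 𝓝 p, 0 < u y + η)
    (hG : G (u p) < a ^ 3 * (a - 1) * S ^ 4 * (u p + η) ^ (3 - 4 / a)) :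
    ¬ IsLocalMin (fun y => (u y + η) ^ a⁻¹ + S * ‖y - z‖) p := by
  intro hmin
  set v : Rn n → ℝ := fun y => (u y + η) ^ a⁻¹
  have hvp : 0 < v p := Real.rpow_pos_of_pos hpos.self_of_nhds _
  have hvpow {y : Rn n} (hy : 0 < u y + η) : v y ^ a = u y + η :=
    Real.rpow_inv_rpow hy.le ha.ne'
  set b := v p + S * ‖p - z‖
  have hb : b - S * ‖p - z‖ = v p := add_sub_cancel_right _ _
  have hcone : ∀ᶠ y in 𝓝 p, 0 < b - S * ‖y - z‖ := by
    have hcont : ContinuousAt (fun y => b - S * ‖y - z‖) p := by fun_prop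
    exact hcont.eventually (lt_mem_nhds (by simpa only [hb] using hvp))
  have htouch : IsLocalMin (fun y => u y - (b - S * ‖y - z‖) ^ a) p := by
    filter_upwards [hmin, hpos, hcone] with y hvy huy hby
    have hle : (b - S * ‖y - z‖) ^ a ≤ v y ^ a := by
      gcongr
      exact sub_le_iff_le_add.2 hvy
    rw [hvpow huy] at hle
    rw [hb, hvpow hpos.self_of_nhds]
    linarith
  have hsup := hu p hp _ (contDiffAt_cone_rpow hpz hcone.self_of_nhds) htouch
  have hexp : v p ^ (3 * a - 4) = (u p + η) ^ (3 - 4 / a) := by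
    rw [← Real.rpow_mul hpos.self_of_nhds.le]
    congr 1
    field_simp
  rw [infLaplacian_cone_rpow hpz hcone.self_of_nhds, hb, hexp] at hsup
  exact hG.not_ge hsup

theorem IsViscositySupersolution.rpow_le_add_mul_norm_sub {R : ℝ} {y : Rn n}
    (hu : IsViscositySupersolution Ω G u) (hc : ContinuousOn u (Metric.closedBall z R))
    (hball : Metric.closedBall z R ⊆ Ω) (h0 : ∀ p ∈ Metric.closedBall z R, 0 ≤ u p)
    (ha : 0 < a) (hη : 0 < η) (hS : 0 ≤ S)
    (hG : ∀ s, 0 ≤ s → G s < a ^ 3 * (a - 1) * S ^ 4 * (s + η) ^ (3 - 4 / a))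
    (hz : (u z + η) ^ a⁻¹ ≤ S * R) (hy : y ∈ Metric.closedBall z R) :
    (u z + η) ^ a⁻¹ ≤ (u y + η) ^ a⁻¹ + S * ‖y - z‖ := by
  have hpos {p : Rn n} (hp : p ∈ Metric.closedBall z R) : 0 < u p + η :=
    add_pos_of_nonneg_of_pos (h0 p hp) hη
  refine le_add_mul_norm_sub_of_not_isLocalMin (v := fun y => (u y + η) ^ a⁻¹)
    ((hc.add continuousOn_const).rpow_const fun p hp => Or.inl (hpos hp).ne')
    (fun p hp => Real.rpow_nonneg (hpos hp).le _) hS hz (fun p hp hpz => ?_) hy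
  have hpz' := Metric.ball_subset_closedBall hp
  exact hu.not_isLocalMin_rpow_add_norm_sub (hball hpz') hpz ha
    (mem_of_superset (Metric.closedBall_mem_nhds_of_mem hp) fun _ => hpos) (hG _ (h0 p hpz'))

end Comparison

section Source

variable {γ δ ε s S : ℝ} {B : ℝ → ℝ}

theorem alpha_pos (hγ : 0 ≤ γ) : 0 < alpha γ := by
  unfold alpha
  positivity

theorem one_lt_alpha (hγ : 0 ≤ γ) (hγ1 : γ < 1) : 1 < alpha γ := by
  rw [alpha, one_lt_div (by linarith)]
  linarith

theorem four_div_alpha (γ : ℝ) : 4 / alpha γ = 3 + γ :=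
  div_div_cancel₀ four_ne_zero

theorem eight_mul_rpow_alpha_pow_div_lt (hγ : 0 ≤ γ) {r : ℝ} (hr : 0 < r) :
    8 * ((r / 2) ^ alpha γ) ^ 3 / r ^ 4 < ((r / 2) ^ alpha γ) ^ (-γ) := by
  set L : ℝ := (r / 2) ^ alpha γ with hL
  have hL0 : 0 < L := by positivity
  have hexp : alpha γ * (3 + γ) = 4 := div_mul_cancel₀ 4 (by positivity)
  have hL4 : L ^ (3 + γ) = (r / 2) ^ 4 := by
    rw [hL, ← Real.rpow_mul (by positivity), hexp]
    exact_mod_cast Real.rpow_natCast (r / 2) 4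
  have hL3 : L ^ 3 = (r / 2) ^ 4 * L ^ (-γ) := by
    rw [← hL4, ← Real.rpow_add hL0, add_neg_cancel_right]
    exact_mod_cast (Real.rpow_natCast L 3).symm
  calc 8 * L ^ 3 / r ^ 4 = L ^ (-γ) / 2 := by
        rw [hL3]
        field_simp
        norm_num
    _ < L ^ (-γ) := half_lt_self (Real.rpow_pos_of_pos hL0 _)

theorem IsCutoff.source_eq_rpow (hB : IsCutoff δ B) (hε : 0 < ε) (hs : δ * ε ^ alpha γ ≤ s) :
    source γ B ε s = s ^ (-γ) := by
  rw [source, hB.eq_one _ ((le_div_iff₀ (Real.rpow_pos_of_pos hε _)).2 hs), one_mul]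

theorem IsCutoff.source_le (hB : IsCutoff δ B) (hδ : 0 < δ) (hγ : 0 ≤ γ) (hε : 0 < ε)
    (hs : 0 ≤ s) : source γ B ε s ≤ 3 ^ γ * (s + δ * ε ^ alpha γ) ^ (-γ) := by
  have hscale : 0 < ε ^ alpha γ := Real.rpow_pos_of_pos hε _
  rcases le_or_gt (s / ε ^ alpha γ) (δ / 2) with hsmall | hlarge
  · rw [source, hB.eq_zero _ hsmall, zero_mul]
    positivity
  · have hδs : δ / 2 * ε ^ alpha γ < s := (lt_div_iff₀ hscale).1 hlarge
    calc source γ B ε s ≤ 1 * s ^ (-γ) := by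
          unfold source
          gcongr
          exact hB.le_one _ (by positivity)
      _ = 3 ^ γ * (3 * s) ^ (-γ) := by
          rw [Real.mul_rpow (by norm_num) hs, ← mul_assoc, ← Real.rpow_add (by norm_num),
            add_neg_cancel, Real.rpow_zero]
      _ ≤ 3 ^ γ * (s + δ * ε ^ alpha γ) ^ (-γ) := by
          gcongr 3 ^ γ * ?_
          exact Real.rpow_le_rpow_of_nonpos (by positivity) (by linarith) (by linarith)

/-- The slopes `S` for which the powers `(b - S |x|) ^ α` of cones, which solve
`Δ_∞ w = α³ (α - 1) S⁴ w ^ (-γ)`, have a source exceeding the bound `3 ^ γ (w + η) ^ (-γ)` of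
`IsCutoff.source_le`, so that they can touch no penalized solution from below. -/
structure IsBarrierSlope (γ S : ℝ) : Prop where
  pos : 0 < S
  source_lt : 3 ^ γ < alpha γ ^ 3 * (alpha γ - 1) * S ^ 4

theorem exists_isBarrierSlope (hγ : 0 ≤ γ) (hγ1 : γ < 1) (t : ℝ) :
    ∃ S, 1 ≤ S ∧ t < S ∧ IsBarrierSlope γ S := by
  have hcoeff : 0 < alpha γ ^ 3 * (alpha γ - 1) :=
    mul_pos (pow_pos (alpha_pos hγ) 3) (sub_pos.2 (one_lt_alpha hγ hγ1))
  have hsource : ∀ᶠ S : ℝ in atTop, 3 ^ γ < alpha γ ^ 3 * (alpha γ - 1) * S ^ 4 :=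
    ((tendsto_pow_atTop four_ne_zero).const_mul_atTop hcoeff).eventually_gt_atTop _
  obtain ⟨S, hS, hSt, hS1⟩ :=
    (hsource.and ((eventually_gt_atTop t).and (eventually_ge_atTop 1))).exists
  exact ⟨S, hS1, hSt, zero_lt_one.trans_le hS1, hS⟩

theorem IsBarrierSlope.source_lt_of_isCutoff (hS : IsBarrierSlope γ S) (hB : IsCutoff δ B)
    (hδ : 0 < δ) (hγ : 0 ≤ γ) (hε : 0 < ε) (hs : 0 ≤ s) :
    source γ B ε s <
      alpha γ ^ 3 * (alpha γ - 1) * S ^ 4 * (s + δ * ε ^ alpha γ) ^ (3 - 4 / alpha γ) := by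
  rw [four_div_alpha, show 3 - (3 + γ) = -γ by ring]
  have hpos : 0 < s + δ * ε ^ alpha γ := by positivity
  exact (hB.source_le hδ hγ hε hs).trans_lt
    (mul_lt_mul_of_pos_right hS.source_lt (Real.rpow_pos_of_pos hpos _))

end Source

section Limit

variable {n : ℕ} {γ δ : ℝ} {B : ℝ → ℝ} {Ω : Set (Rn n)} {u : Rn n → ℝ}

/-- A nonnegative continuous viscosity solution of `Δ_∞ u = G(u)` in `Ω`, without reference to
boundary values or to minimality. -/
structure IsNonnegViscositySolution (Ω : Set (Rn n)) (G : ℝ → ℝ) (u : Rn n → ℝ) : Prop where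
  continuousOn : ContinuousOn u Ω
  nonneg : ∀ x ∈ Ω, 0 ≤ u x
  supersolution : IsViscositySupersolution Ω G u
  subsolution : IsViscositySubsolution Ω G u

theorem IsMinimalSolution.isNonnegViscositySolution {G : ℝ → ℝ} {φ : Rn n → ℝ}
    (h : IsMinimalSolution Ω G φ u) : IsNonnegViscositySolution Ω G u where
  continuousOn := h.continuousOn.mono subset_closure
  nonneg x hx := h.nonneg x (subset_closure hx)
  supersolution := h.supersolution
  subsolution := h.subsolution

/-- A locally uniform limit in `Ω` of arbitrary nonnegative viscosity solutions of
`Δ_∞ u_k = 𝓑_{ε_k}(u_k) u_k^{-γ}`, `ε_k → 0⁺`. It generalizes `IsLimitingSolution`, which requires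
the `u_k` to be minimal for convergent boundary data. -/
def IsPenalizedLimit (γ : ℝ) (B : ℝ → ℝ) (Ω : Set (Rn n)) (u : Rn n → ℝ) : Prop :=
  ∃ (ε : ℕ → ℝ) (us : ℕ → Rn n → ℝ),
    (∀ k, 0 < ε k) ∧ Tendsto ε atTop (𝓝 0) ∧
    (∀ k, IsNonnegViscositySolution Ω (source γ B (ε k)) (us k)) ∧
    TendstoLocallyUniformlyOn us u atTop Ω

theorem IsLimitingSolution.isPenalizedLimit {φ : Rn n → ℝ} (h : IsLimitingSolution γ B Ω φ u) :
    IsPenalizedLimit γ B Ω u := by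
  obtain ⟨ε, φs, us, hε, hε0, -, -, hmin, hlim⟩ := h
  exact ⟨ε, us, hε, hε0, fun k => (hmin k).isNonnegViscositySolution, hlim⟩

theorem tendsto_mul_rpow_alpha (hγ : 0 ≤ γ) {ε : ℕ → ℝ} (hε : Tendsto ε atTop (𝓝 0)) :
    Tendsto (fun k => δ * ε k ^ alpha γ) atTop (𝓝 0) := by
  have h := (hε.rpow_const (Or.inr (alpha_pos hγ).le)).const_mul δ
  rwa [Real.zero_rpow (alpha_pos hγ).ne', mul_zero] at h

namespace IsPenalizedLimit

theorem continuousOn (h : IsPenalizedLimit γ B Ω u) : ContinuousOn u Ω := by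
  obtain ⟨ε, us, -, -, hsol, hlim⟩ := h
  exact hlim.continuousOn (Frequently.of_forall fun k => (hsol k).continuousOn)

theorem nonneg (h : IsPenalizedLimit γ B Ω u) {x : Rn n} (hx : x ∈ Ω) : 0 ≤ u x := by
  obtain ⟨ε, us, -, -, hsol, hlim⟩ := h
  exact ge_of_tendsto' (hlim.tendsto_at hx) fun k => (hsol k).nonneg x hx

theorem exists_half_le_rpow (h : IsPenalizedLimit γ B Ω u) (hγ : 0 ≤ γ) (hB : IsCutoff δ B)
    (hδ : 0 < δ) (hΩ : IsOpen Ω) {x : Rn n} {r : ℝ} (hr : 0 < r)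
    (hball : Metric.closedBall x r ⊆ Ω) (hx : 0 < u x) :
    ∃ z ∈ Metric.closedBall x r, r / 2 ≤ u z ^ (alpha γ)⁻¹ := by
  have hα := alpha_pos hγ
  have hxr : x ∈ Metric.closedBall x r := Metric.mem_closedBall_self hr.le
  set L : ℝ := (r / 2) ^ alpha γ
  obtain ⟨z, hz, hmax⟩ := (isCompact_closedBall x r).exists_isMaxOn ⟨x, hxr⟩
    (h.continuousOn.mono hball)
  suffices hLz : L ≤ u z from
    ⟨z, hz, (Real.le_rpow_inv_iff_of_pos (by positivity) (h.nonneg (hball hz)) hα).2 hLz⟩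
  by_contra! hzL
  obtain ⟨ε, us, hε, hε0, hsol, hlim⟩ := h
  have hunif := (tendstoLocallyUniformlyOn_iff_forall_isCompact hΩ).1 hlim _ hball
    (isCompact_closedBall x r)
  have hclose := Metric.tendstoUniformlyOn_iff.1 hunif (L - u z) (sub_pos.2 hzL)
  have hηx := (tendsto_mul_rpow_alpha (δ := δ) hγ hε0).eventually_lt
    (hlim.tendsto_at (hball hxr)) hx
  obtain ⟨k, hk, hkx⟩ := (hclose.and hηx).exists
  have hη : 0 < δ * ε k ^ alpha γ := mul_pos hδ (Real.rpow_pos_of_pos (hε k) _)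
  have hsource : ∀ s ∈ Icc (us k x) L, 8 * L ^ 3 / r ^ 4 < source γ B (ε k) s := by
    rintro s ⟨hxs, hsL⟩
    have hs : 0 < s := hη.trans (hkx.trans_le hxs)
    rw [hB.source_eq_rpow (hε k) (hkx.le.trans hxs)]
    exact (eight_mul_rpow_alpha_pow_div_lt hγ hr).trans_le
      (Real.rpow_le_rpow_of_nonpos hs hsL (neg_nonpos.2 hγ))
  obtain ⟨y, hy, hyL⟩ := (hsol k).subsolution.exists_lt ((hsol k).continuousOn.mono hball) hball hr
    (hη.trans hkx) hsource
  have hdist := hk y hy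
  rw [Real.dist_eq, abs_lt] at hdist
  have hyz : u y ≤ u z := hmax hy
  linarith

theorem rpow_le_add_mul_norm_sub (h : IsPenalizedLimit γ B Ω u) (hγ : 0 ≤ γ)
    (hB : IsCutoff δ B) (hδ : 0 < δ) {S R : ℝ} (hS : IsBarrierSlope γ S) {y z : Rn n}
    (hball : Metric.closedBall z R ⊆ Ω) (hz : u z ^ (alpha γ)⁻¹ < S * R)
    (hy : y ∈ Metric.closedBall z R) :
    u z ^ (alpha γ)⁻¹ ≤ u y ^ (alpha γ)⁻¹ + S * ‖y - z‖ := by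
  obtain ⟨ε, us, hε, hε0, hsol, hlim⟩ := h
  have hα := alpha_pos hγ
  have hzR : z ∈ Metric.closedBall z R := Metric.mem_closedBall_self (dist_nonneg.trans hy)
  have hroot {x : Rn n} (hx : x ∈ Ω) :
      Tendsto (fun k => (us k x + δ * ε k ^ alpha γ) ^ (alpha γ)⁻¹) atTop
        (𝓝 (u x ^ (alpha γ)⁻¹)) := by
    have hsum := (hlim.tendsto_at hx).add (tendsto_mul_rpow_alpha (δ := δ) hγ hε0)
    rw [add_zero] at hsum
    exact hsum.rpow_const (Or.inr (inv_nonneg.2 hα.le))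
  refine le_of_tendsto_of_tendsto (hroot (hball hzR)) ((hroot (hball hy)).add_const _) ?_
  filter_upwards [(hroot (hball hzR)).eventually (gt_mem_nhds hz)] with k hk
  exact (hsol k).supersolution.rpow_le_add_mul_norm_sub ((hsol k).continuousOn.mono hball) hball
    (fun p hp => (hsol k).nonneg p (hball hp)) hα (mul_pos hδ (Real.rpow_pos_of_pos (hε k) _))
    hS.pos.le (fun s hs => hS.source_lt_of_isCutoff hB hδ hγ (hε k) hs) hk.le hy

theorem ball_subset_posSet (h : IsPenalizedLimit γ B Ω u) (hγ : 0 ≤ γ) (hB : IsCutoff δ B)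
    (hδ : 0 < δ) {S R : ℝ} (hS : IsBarrierSlope γ S) {z : Rn n}
    (hball : Metric.closedBall z R ⊆ Ω) (hz : u z ^ (alpha γ)⁻¹ < S * R) :
    Metric.ball z (u z ^ (alpha γ)⁻¹ / S) ⊆ posSet Ω u := by
  intro y hy
  rw [Metric.mem_ball, lt_div_iff₀' hS.pos] at hy
  have hyR : y ∈ Metric.closedBall z R := (lt_of_mul_lt_mul_left (hy.trans hz) hS.pos.le).le
  have hcone := h.rpow_le_add_mul_norm_sub hγ hB hδ hS hball hz hyR
  rw [← dist_eq_norm] at hcone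
  refine ⟨hball hyR, (h.nonneg (hball hyR)).lt_of_ne' fun hy0 => ?_⟩
  rw [hy0, Real.zero_rpow (inv_pos.2 (alpha_pos hγ)).ne'] at hcone
  linarith

theorem exists_ball_subset_inter_posSet (h : IsPenalizedLimit γ B Ω u) (hγ : 0 ≤ γ)
    (hB : IsCutoff δ B) (hδ : 0 < δ) (hΩ : IsOpen Ω) {S N d κ : ℝ} (hS : IsBarrierSlope γ S)
    (hS1 : 1 ≤ S) (hN : ∀ y ∈ Ω, u y ≤ N) (hSN : N ^ (alpha γ)⁻¹ < S * (d / 4)) {x : Rn n}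
    (hball : Metric.ball x d ⊆ Ω) (hx : 0 < u x) (hκ : 0 < κ) (hκd : κ < d) :
    ∃ z, Metric.ball z ((4 * S)⁻¹ * κ) ⊆ Metric.ball x κ ∩ posSet Ω u := by
  obtain ⟨z, hz, hzκ⟩ := h.exists_half_le_rpow hγ hB hδ hΩ (half_pos hκ)
    ((Metric.closedBall_subset_ball (by linarith)).trans hball) hx
  rw [Metric.mem_closedBall] at hz
  have hzball : Metric.closedBall z (d / 4) ⊆ Ω :=
    (Metric.closedBall_subset_ball' (by linarith)).trans hball
  have hzΩ : z ∈ Ω := hzball (Metric.mem_closedBall_self (by linarith))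
  have hzd : u z ^ (alpha γ)⁻¹ < S * (d / 4) :=
    (Real.rpow_le_rpow (h.nonneg hzΩ) (hN z hzΩ) (inv_nonneg.2 (alpha_pos hγ).le)).trans_lt hSN
  have hradius : (4 * S)⁻¹ * κ = κ / 4 / S := by field_simp
  refine ⟨z, subset_inter (Metric.ball_subset_ball' ?_) ?_⟩
  · have : κ / 4 / S ≤ κ / 4 := div_le_self (by linarith) hS1
    linarith
  · refine (Metric.ball_subset_ball ?_).trans (h.ball_subset_posSet hγ hB hδ hS hzball hzd)
    rw [hradius]
    gcongr
    linarith

end IsPenalizedLimit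

end Limit

end SingInfLap

open SingInfLap in
theorem corollary5p4_general (n : ℕ) (γ : ℝ) (hγ0 : 0 ≤ γ) (hγ1 : γ < 1) (M d : ℝ) :
    ∃ c τ : ℝ, 0 < c ∧ 0 < τ ∧ τ < 1 / 2 ∧
      ∀ (δ : ℝ) (B : ℝ → ℝ) (Ω : Set (Rn n)) (u : Rn n → ℝ),
        0 < δ → IsCutoff δ B → IsOpen Ω → IsPenalizedLimit γ B Ω u →
        eLpNorm u ∞ (volume.restrict Ω) ≤ ENNReal.ofReal M →
        ∀ x : Rn n, Metric.ball x d ⊆ Ω →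
          (x ∈ posSet Ω u → ∀ κ : ℝ, 0 < κ → κ < d →
            c ≤ volume.real (Metric.ball x κ ∩ posSet Ω u) / volume.real (Metric.ball x κ)) ∧
          (x ∈ frontier (posSet Ω u) → PorousAt τ d (frontier (posSet Ω u)) x) := by
  obtain ⟨S, hS1, hSN, hS⟩ :=
    exists_isBarrierSlope hγ0 hγ1 (max M 0 ^ (alpha γ)⁻¹ / (d / 8))
  have hS0 := hS.pos
  have hσ : (4 * S)⁻¹ < 1 := inv_lt_one_of_one_lt₀ (by linarith)
  refine ⟨(4 * S)⁻¹ ^ n, (4 * S)⁻¹ / 2, by positivity, by positivity, by linarith,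
    fun δ B Ω u hδ hB hΩ hu hM x hball => ?_⟩
  -- Porosity uses this at points `y` near `x` around which only half of the room `d` is left,
  -- hence the `d / 8` in the choice of `S`.
  have hinner {y : Rn n} {κ r : ℝ} (hy : y ∈ posSet Ω u) (hr : Metric.ball y r ⊆ Ω)
      (hdr : d / 2 ≤ r) (hκ : 0 < κ) (hκd : κ < r) (hd : 0 < d) :
      ∃ z, Metric.ball z ((4 * S)⁻¹ * κ) ⊆ Metric.ball y κ ∩ posSet Ω u := by
    refine hu.exists_ball_subset_inter_posSet hγ0 hB hδ hΩ hS hS1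
      (fun w hw => le_max_of_eLpNorm_top_restrict_le hΩ hu.continuousOn hM hw) ?_ hr hy.2 hκ hκd
    rw [div_lt_iff₀ (by linarith)] at hSN
    exact hSN.trans_le (mul_le_mul_of_nonneg_left (by linarith) hS0.le)
  refine ⟨fun hx κ hκ hκd => ?_, fun hx ρ hρ hρd => ?_⟩
  · obtain ⟨z, hz⟩ := hinner hx hball (by linarith) hκ hκd (hκ.trans hκd)
    simpa using pow_finrank_le_measureReal_div volume (by positivity) hκ hz
  · refine exists_ball_subset_sdiff_frontier hρ hx.1 fun y hy hyx => ?_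
    exact hinner hy ((Metric.ball_subset_ball' (by linarith)).trans hball) le_rfl
      (half_pos hρ) (by linarith) (hρ.trans hρd)

theorem corollary5p4 (n : ℕ) (γ : ℝ) (hγ0 : 0 ≤ γ) (hγ1 : γ < 1) (M d : ℝ) :
    ∃ c τ : ℝ, 0 < c ∧ 0 < τ ∧ τ < 1 / 2 ∧
      ∀ (δ : ℝ) (B : ℝ → ℝ) (Ω Ω' : Set (SingInfLap.Rn n)) (φ u : SingInfLap.Rn n → ℝ),
        0 < δ → SingInfLap.IsCutoff δ B →
        IsOpen Ω → IsConnected Ω → Bornology.IsBounded Ω →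
        IsOpen Ω' → IsConnected Ω' → IsCompact (closure Ω') → closure Ω' ⊆ Ω →
        SingInfLap.IsLimitingSolution γ B Ω φ u →
        eLpNorm u ∞ (volume.restrict Ω) ≤ ENNReal.ofReal M →
        SingInfLap.setDist Ω' (frontier Ω) = d →
        (∀ x ∈ Ω' ∩ SingInfLap.posSet Ω u, ∀ κ : ℝ, 0 < κ → κ < d →
          c ≤ volume.real (Metric.ball x κ ∩ SingInfLap.posSet Ω u) /
            volume.real (Metric.ball x κ)) ∧
        (∀ x ∈ Ω' ∩ frontier (SingInfLap.posSet Ω u),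
          SingInfLap.PorousAt τ d (frontier (SingInfLap.posSet Ω u)) x) := by
  obtain ⟨c, τ, hc, hτ, hτ', H⟩ := corollary5p4_general n γ hγ0 hγ1 M d
  refine ⟨c, τ, hc, hτ, hτ', fun δ B Ω Ω' φ u hδ hB hΩ _ _ _ _ _ hΩ' hu hM hd => ?_⟩
  have hx {x} (hx : x ∈ Ω') := H δ B Ω u hδ hB hΩ hu.isPenalizedLimit hM x
    (hd ▸ SingInfLap.ball_setDist_frontier_subset hΩ hx (hΩ' (subset_closure hx)))
  exact ⟨fun x h => (hx h.1).1 h.2, fun x h => (hx h.1).2 h.2⟩
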